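/- Let $P_n=(P,L)$ be a finite projective plane of order $n$, with point set $P$ and line set $L$. For a coloring $f$ with colors $\{1,\dots,k\}$ of all or of some of the points, the type of a line $\ell$ is the vector $t_{\ell,f}=(|\ell\cap f^{-1}(1)|,\dots,|\ell\cap f^{-1}(k)|)$. A coloring of all points is called legitimate if distinct lines have distinct types. Fix a set $S\subseteq P$ with $\ln n\le|\ell\cap S|\le 11\ln n$ for every line $\ell\in L$. For a partial coloring $f\colon P\setminus S\to\{1,\dots,d\}$, two distinct lines $\ell,\ell'$ form a dangerous pair $\{\ell,\ell'\}$ if $\sum_{i=1}^{d}\bigl|\,|\ell\cap f^{-1}(i)|-|\ell'\cap f^{-1}(i)|\,\bigr|\le 22\ln n$; a point belongs to this pair if it lies on $\ell$ or on $\ell'$. Let $a,b\ge 0$ be integers and let $d=\mathsf d(n,a,b)$ be a number of colors (for instance the least one) for which there is a partial coloring $f\colon P\setminus S\to\{1,\dots,d\}$ such that no point of $S$ belongs to more than $a\cdot b$ dangerous pairs. Then $P_n$ has a legitimate coloring with $$\max\Bigl(d,\ \Bigl\lceil \min_{m\ge 2}\ \frac{m}{m-1}\bigl(m!\,a\,b\,(m-1)\bigr)^{1/m}\Bigr\rceil\Bigr)$$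 colors (not all of which have to be used), where $m$ runs over the integers $\ge 2$. -/

import Mathlib

open Configuration

/-- The type of a line `l` with respect to a colouring `f` of the points with colours
`0, …, k - 1`: the vector whose `i`-th entry is the number of points of `l` of colour `i`. -/
noncomputable def lineType {P L : Type*} [Membership P L] {k : ℕ}
    (f : P → Fin k) (l : L) : Fin k → ℕ :=
  fun i => {p : P | p ∈ l ∧ f p = i}.ncard

/-- A colouring of the points is legitimate if distinct lines have distinct types. -/
def IsLegitimate {P : Type*} (L : Type*) [Membership P L] {k : ℕ} (f : P → Fin k) : Prop :=
  ∀ l₁ l₂ : L, l₁ ≠ l₂ → lineType f l₁ ≠ lineType f l₂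

/-- The type of a line `l` with respect to a partial colouring, defined on the complement of `S`:
only the coloured points are counted. -/
noncomputable def partialLineType {P L : Type*} [Membership P L] {S : Set P} {d : ℕ}
    (f : {p : P // p ∉ S} → Fin d) (l : L) : Fin d → ℕ :=
  fun i => {p : {p : P // p ∉ S} | p.1 ∈ l ∧ f p = i}.ncard

/-- Two lines form a dangerous pair (in a plane of order `n`) if they are distinct and
the `ℓ¹`-distance of their types is at most `22 ln n`. -/
def IsDangerousPair {P L : Type*} [Membership P L] (n : ℕ) {S : Set P} {d : ℕ}
    (f : {p : P // p ∉ S} → Fin d) (l₁ l₂ : L) : Prop :=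
  l₁ ≠ l₂ ∧
    ∑ i, |(partialLineType f l₁ i : ℝ) - (partialLineType f l₂ i : ℝ)| ≤ 22 * Real.log n

/-- The set of dangerous (unordered) pairs to which the point `p` belongs,
that is, for which `p` is on one of the two lines. -/
def dangerousPairsAt {P : Type*} (L : Type*) [Membership P L] (n : ℕ) {S : Set P} {d : ℕ}
    (f : {p : P // p ∉ S} → Fin d) (p : P) : Set (Sym2 L) :=
  {e | ∃ l₁ l₂ : L, e = s(l₁, l₂) ∧ IsDangerousPair n f l₁ l₂ ∧ (p ∈ l₁ ∨ p ∈ l₂)}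

/-- Every line has at least `ln n` and at most `11 ln n` points in `S`. -/
def IsBalancedSet {P : Type*} (L : Type*) [Membership P L] (n : ℕ) (S : Set P) : Prop :=
  ∀ l : L, Real.log n ≤ ({p : P | p ∈ l ∧ p ∈ S}.ncard : ℝ) ∧
    ({p : P | p ∈ l ∧ p ∈ S}.ncard : ℝ) ≤ 11 * Real.log n

/-- `d` colours suffice for a partial colouring of the points outside `S` such that
no point of `S` belongs to more than `a * b` dangerous pairs. -/
def ColorsSuffice {P : Type*} (L : Type*) [Membership P L] (n : ℕ) (S : Set P)
    (a b d : ℕ) : Prop :=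
  ∃ f : {p : P // p ∉ S} → Fin d, ∀ p ∈ S, (dangerousPairsAt L n f p).ncard ≤ a * b

/-- The quantity `min_{m ≥ 2} (m / (m - 1)) * (m! * a * b * (m - 1)) ^ (1 / m)`. -/
noncomputable def entropyBound (a b : ℕ) : ℝ :=
  sInf ((fun m : ℕ => (m : ℝ) / ((m : ℝ) - 1) *
    ((m.factorial : ℝ) * (a : ℝ) * (b : ℝ) * ((m : ℝ) - 1)) ^ (1 / (m : ℝ))) '' {m : ℕ | 2 ≤ m})

/-!
Colour `S` by the local lemma, in the form of Rosenfeld's counting argument. Since an uncoloured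
point of a dangerous pair lies with `m - 1` further points of `S` on `l₁ \ l₂`, and the type of `l₂`
does not depend on these `m` points, at most `m!` of their `k ^ m` colourings give the two lines
equal types. The resulting budget is the condition that the `m`-th term of `entropyBound a b` is at
most `k`.

This needs `m + 1` points of `S` on every line. For `n > 1096` the bound `ln n > 7` provides them
when `m ≤ 7`; for `k ≤ 9` a larger `m` can be lowered to `7`, and for `k ≥ 10` a uniformly random
colouring of all points is legitimate with positive probability. For `n ≤ 1096` dangerous pairs are
abundant (all pairs are dangerous for `n ≤ 30`, and a second moment computation yields many of them
beyond), so that the condition on `k` makes `k` large enough for a random colouring.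
-/

section ColourCounts

open Finset
open scoped Nat

/-- The product of the factorials of the parts of the balanced composition of `n` into `k` parts,
that is, the smallest denominator of a multinomial coefficient with `k` parts and sum `n`.
The points are dealt to the parts in turn, the `j`-th one becoming element number `j / k + 1` of
its part. -/
def balancedFactorialProd (k n : ℕ) : ℕ :=
  ∏ j ∈ range n, (j / k + 1)

lemma balancedFactorialProd_succ (k n : ℕ) :
    balancedFactorialProd k (n + 1) = balancedFactorialProd k n * (n / k + 1) :=
  prod_range_succ _ _

lemma balancedFactorialProd_pos (k n : ℕ) : 0 < balancedFactorialProd k n :=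
  prod_pos fun _ _ ↦ Nat.succ_pos _

lemma balancedFactorialProd_le_prod_factorial {ι : Type*} [Fintype ι] (t : ι → ℕ) :
    balancedFactorialProd (Fintype.card ι) (∑ i, t i) ≤ ∏ i, (t i)! := by
  classical
  induction hn : ∑ i, t i generalizing t with
  | zero => exact Nat.succ_le_of_lt (prod_pos fun i _ ↦ (t i).factorial_pos)
  | succ n ih =>
    obtain ⟨i, hi⟩ : ∃ i, n / Fintype.card ι + 1 ≤ t i := by
      by_contra! h
      have : ∑ i, t i ≤ Fintype.card ι * (n / Fintype.card ι) := by
        simpa using sum_le_card_nsmul univ t _ fun i _ ↦ Nat.lt_succ_iff.mp (h i)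
      have := Nat.mul_div_le n (Fintype.card ι)
      lia
    have hfact : ∏ j, (t j)! = (∏ j, (Function.update t i (t i - 1) j)!) * t i := by
      rw [← mul_prod_erase univ _ (mem_univ i), ← mul_prod_erase univ _ (mem_univ i),
        Function.update_self, ← Nat.mul_factorial_pred (show t i ≠ 0 by lia)]
      have : ∏ j ∈ univ.erase i, (Function.update t i (t i - 1) j)! = ∏ j ∈ univ.erase i, (t j)! :=
        prod_congr rfl fun j hj ↦ by rw [Function.update_of_ne (ne_of_mem_erase hj)]
      rw [this]
      ring
    have hsum : ∑ j, Function.update t i (t i - 1) j = n := by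
      have := add_sum_erase univ t (mem_univ i)
      rw [sum_update_of_mem (mem_univ i), sdiff_singleton_eq_erase]
      lia
    rw [hfact, balancedFactorialProd_succ]
    exact Nat.mul_le_mul (ih _ hsum) hi

lemma factorial_mul_balancedFactorialProd_le {k a b : ℕ} (hk : 0 < k) (hab : a ≤ b) :
    b ! * (k ^ a * balancedFactorialProd k a) ≤ a ! * (k ^ b * balancedFactorialProd k b) := by
  induction b, hab using Nat.le_induction with
  | base => rfl
  | succ b _ ih =>
    have hstep : b + 1 ≤ k * (b / k + 1) := Nat.lt_mul_div_succ b hk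
    calc (b + 1)! * (k ^ a * balancedFactorialProd k a)
        = (b + 1) * (b ! * (k ^ a * balancedFactorialProd k a)) := by
          rw [Nat.factorial_succ, mul_assoc]
      _ ≤ (k * (b / k + 1)) * (a ! * (k ^ b * balancedFactorialProd k b)) :=
          Nat.mul_le_mul hstep ih
      _ = a ! * (k ^ (b + 1) * balancedFactorialProd k (b + 1)) := by
          rw [balancedFactorialProd_succ]
          ring

lemma exists_perm_comp_eq_of_card_fibre_eq {α K : Type*} [Fintype α] [DecidableEq K] {f g : α → K}
    (h : ∀ i, #{a | g a = i} = #{a | f a = i}) : ∃ σ : Equiv.Perm α, f ∘ σ = g := by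
  have e (i : K) : {a // g a = i} ≃ {a // f a = i} :=
    Fintype.equivOfCardEq (by simpa only [Fintype.card_subtype] using h i)
  exact ⟨Equiv.ofFiberEquiv e, funext fun a ↦ Equiv.ofFiberEquiv_map e a⟩

lemma card_maps_same_fibre_cards_mul_le {α K : Type*} [Fintype α] [DecidableEq α] [Fintype K]
    [DecidableEq K] (f : α → K) :
    #{g : α → K | ∀ i, #{a | g a = i} = #{a | f a = i}} * ∏ i, (#{a | f a = i})!
      ≤ (Fintype.card α)! := by
  have hcoset : ∀ g ∈ ({g | ∀ i, #{a | g a = i} = #{a | f a = i}} : Finset (α → K)),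
      ∏ i, (#{a | f a = i})! = #{σ : Equiv.Perm α | f ∘ σ = g} := by
    intro g hg
    obtain ⟨τ, rfl⟩ := exists_perm_comp_eq_of_card_fibre_eq (by simpa using hg)
    simp_rw [← Fintype.card_subtype, ← DomMulAct.stabilizer_card f]
    refine Fintype.card_congr ((Equiv.mulRight τ).subtypeEquiv fun σ ↦ ?_)
    exact (τ.surjective.injective_comp_right.eq_iff (a := f ∘ σ) (b := f)).symm
  calc _ = ∑ g : α → K with ∀ i, #{a | g a = i} = #{a | f a = i},
          #{σ : Equiv.Perm α | f ∘ σ = g} := by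
        rw [← sum_congr rfl hcoset, sum_const, smul_eq_mul]
    _ ≤ (Fintype.card α)! := by
        rw [sum_card_fiberwise_eq_card_filter, ← Fintype.card_perm]
        exact card_le_univ _

/-- The colourings that agree with `c` outside `A`. -/
def recolourings {V K : Type*} [Fintype V] [DecidableEq V] [Fintype K] (A : Finset V)
    (c : V → K) : Finset (V → K) :=
  Fintype.piFinset fun v ↦ if v ∈ A then univ else {c v}

section Recolourings

variable {V K : Type*} [Fintype V] [DecidableEq V] [Fintype K] {A : Finset V} {c c' : V → K}

lemma mem_recolourings : c' ∈ recolourings A c ↔ ∀ v ∉ A, c' v = c v := by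
  refine Fintype.mem_piFinset.trans (forall_congr' fun v ↦ ?_)
  by_cases hv : v ∈ A <;> simp [hv]

lemma mem_recolourings_comm : c' ∈ recolourings A c ↔ c ∈ recolourings A c' := by
  simp only [mem_recolourings, eq_comm]

lemma card_recolourings (A : Finset V) (c : V → K) :
    #(recolourings A c) = Fintype.card K ^ #A := by
  simp only [recolourings, Fintype.card_piFinset, apply_ite Finset.card, card_univ,
    card_singleton, prod_ite, prod_const, one_pow, mul_one, filter_univ_mem]

lemma card_recolourings_fibre_cards_mul_le [DecidableEq K] (A : Finset V) (c : V → K)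
    (t : K → ℕ) :
    #{c' ∈ recolourings A c | ∀ i, #{v ∈ A | c' v = i} = t i}
      * balancedFactorialProd (Fintype.card K) #A ≤ (#A)! := by
  obtain hF | ⟨f, hf⟩ :=
    ({c' ∈ recolourings A c | ∀ i, #{v ∈ A | c' v = i} = t i}).eq_empty_or_nonempty
  · simp [hF]
  have hres (g : V → K) (i : K) : #{a : A | g a = i} = #{v ∈ A | g v = i} := by
    rw [univ_eq_attach, filter_attach (fun v ↦ g v = i), card_map, card_attach]
  have hsum : ∑ i, #{a : A | f a = i} = #A := by
    rw [← card_eq_sum_card_fiberwise fun _ _ ↦ mem_univ _, card_univ, Fintype.card_coe]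
  refine le_trans (Nat.mul_le_mul ?_ ?_)
    ((card_maps_same_fibre_cards_mul_le fun a : A ↦ f a).trans_eq (by rw [Fintype.card_coe]))
  · refine card_le_card_of_injOn (fun g a ↦ g a) (fun g hg ↦ ?_) fun g hg g' hg' h ↦ ?_
    · simp_all
    · simp only [coe_filter, mem_recolourings, Set.mem_ofPred_eq] at hg hg'
      funext v
      by_cases hv : v ∈ A
      · exact congrFun h ⟨v, hv⟩
      · rw [hg.1 v hv, hg'.1 v hv]
  · simpa only [hsum] using balancedFactorialProd_le_prod_factorial fun i ↦ #{a : A | f a = i}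

lemma card_recolourings_piecewise_le {S : Set V} [∀ v, Decidable (v ∈ S)]
    (hA : ↑A ⊆ S) (c h : V → K) (Q : (V → K) → Prop) [DecidablePred Q] :
    #{c' ∈ recolourings A c | Q (S.piecewise c' h)}
      ≤ #{c' ∈ recolourings A (S.piecewise c h) | Q c'} := by
  refine card_le_card_of_injOn (fun c' ↦ S.piecewise c' h) (fun c' hc' ↦ ?_)
    fun c₁ hc₁ c₂ hc₂ heq ↦ funext fun v ↦ ?_
  · simp only [coe_filter, Set.mem_ofPred_eq, mem_recolourings] at hc' ⊢
    exact ⟨fun v hv ↦ by simp only [Set.piecewise, hc'.1 v hv], hc'.2⟩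
  · simp only [coe_filter, Set.mem_ofPred_eq, mem_recolourings] at hc₁ hc₂
    by_cases hv : v ∈ A
    · simpa only [Set.piecewise_eq_of_mem _ _ _ (hA hv)] using congrFun heq v
    · rw [hc₁.1 v hv, hc₂.1 v hv]

end Recolourings

end ColourCounts

section LocalLemma

open Finset Classical

variable {V E K : Type*} [Fintype V] [Fintype K]

lemma card_filter_and_mul_pow_le (A : Finset V) {G Bad : (V → K) → Prop} {B : ℝ}
    (hG : ∀ c, ∀ c' ∈ recolourings A c, G c → G c')
    (hB : ∀ c, (#{c' ∈ recolourings A c | Bad c'} : ℝ) ≤ B) :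
    (#{c | G c ∧ Bad c} : ℝ) * Fintype.card K ^ #A ≤ B * #{c | G c} := by
  have hswap := sum_card_bipartiteAbove_eq_sum_card_bipartiteBelow
    (s := ({c | G c} : Finset (V → K))) (t := ({c | G c ∧ Bad c} : Finset (V → K)))
    fun c c' ↦ c' ∈ recolourings A c
  have hbelow : ∀ c' ∈ ({c | G c ∧ Bad c} : Finset (V → K)),
      #(bipartiteBelow (fun c c' ↦ c' ∈ recolourings A c) {c | G c} c')
        = Fintype.card K ^ #A := by
    intro c' hc'
    rw [← card_recolourings A c']
    congr 1
    ext c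
    simp only [mem_bipartiteBelow, mem_filter, mem_univ, true_and, mem_recolourings_comm (c := c)]
    exact ⟨And.right, fun hc ↦ ⟨hG c' c hc (mem_filter.mp hc').2.1, hc⟩⟩
  have habove : ∀ c,
      (#(bipartiteAbove (fun c c' ↦ c' ∈ recolourings A c) {c | G c ∧ Bad c} c) : ℝ) ≤ B := by
    refine fun c ↦ le_trans (Nat.cast_le.mpr (card_le_card fun c' hc' ↦ ?_)) (hB c)
    simp only [mem_bipartiteAbove, mem_filter, mem_univ, true_and] at hc' ⊢
    exact ⟨hc'.2, hc'.1.2⟩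
  rw [sum_congr rfl hbelow, sum_const, smul_eq_mul] at hswap
  calc (#{c | G c ∧ Bad c} : ℝ) * Fintype.card K ^ #A
      = ∑ c with G c,
          (#(bipartiteAbove (fun c c' ↦ c' ∈ recolourings A c) {c | G c ∧ Bad c} c) : ℝ) := by
        exact_mod_cast hswap.symm
    _ ≤ ∑ c with G c, B := sum_le_sum fun c _ ↦ habove c
    _ = B * #{c | G c} := by rw [sum_const, nsmul_eq_mul, mul_comm]

/-- No event with all its points in `X` occurs for the colouring `c`; here `U e` is the set of
points whose colours decide the event `e`. -/
def AvoidsWithin (U : E → Finset V) (Bad : E → (V → K) → Prop) (X : Finset V) (c : V → K) : Prop :=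
  ∀ e, U e ⊆ X → ¬ Bad e c

/-- The number of colourings for which no event with all its points in `X` occurs, as a real
number. -/
noncomputable def avoidingCount (U : E → Finset V) (Bad : E → (V → K) → Prop) (X : Finset V) : ℝ :=
  #{c : V → K | AvoidsWithin U Bad X c}

variable {U : E → Finset V} {Bad : E → (V → K) → Prop} {β : ℝ} {w : E → ℝ} {X : Finset V}

lemma pow_mul_avoidingCount_le (hβ : 0 ≤ β)
    (h : ∀ Y ⊂ X, ∀ q ∉ Y,
      β * avoidingCount U Bad Y ≤ Fintype.card K * avoidingCount U Bad (insert q Y))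
    (Y Z : Finset V) (hYZ : Disjoint Y Z) (hX : Y ∪ Z ⊆ X) :
    β ^ #Z * avoidingCount U Bad Y
      ≤ (Fintype.card K : ℝ) ^ #Z * avoidingCount U Bad (Y ∪ Z) := by
  induction Z using Finset.induction_on with
  | empty => simp
  | insert a Z ha ih =>
    rw [disjoint_insert_right] at hYZ
    have haYZ : a ∉ Y ∪ Z := by simp [ha, hYZ.1]
    rw [union_insert] at hX ⊢
    rw [card_insert_of_notMem ha]
    have hss : Y ∪ Z ⊂ X := (ssubset_insert haYZ).trans_subset hX
    calc β ^ (#Z + 1) * avoidingCount U Bad Y = β * (β ^ #Z * avoidingCount U Bad Y) := by ring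
      _ ≤ β * (Fintype.card K ^ #Z * avoidingCount U Bad (Y ∪ Z)) :=
          mul_le_mul_of_nonneg_left (ih hYZ.2 hss.subset) hβ
      _ = Fintype.card K ^ #Z * (β * avoidingCount U Bad (Y ∪ Z)) := by ring
      _ ≤ Fintype.card K ^ #Z * (Fintype.card K * avoidingCount U Bad (insert a (Y ∪ Z))) :=
          mul_le_mul_of_nonneg_left (h _ hss a haYZ) (by positivity)
      _ = _ := by ring

lemma card_avoiding_and_bad_mul_le (hβ : 0 < β)
    (hloc : ∀ e c c', (∀ v ∈ U e, c v = c' v) → Bad e c → Bad e c')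
    (hX : ∀ Y ⊂ X, ∀ q ∉ Y,
      β * avoidingCount U Bad Y ≤ Fintype.card K * avoidingCount U Bad (insert q Y))
    {p : V} (hp : p ∉ X) {e : E} (hw : 0 ≤ w e) (heX : U e ⊆ insert p X)
    (hrec : ∃ A ⊆ U e, p ∈ A ∧
      ∀ c, (#{c' ∈ recolourings A c | Bad e c'} : ℝ) ≤ w e * β ^ #(A.erase p)) :
    (#{c : V → K | AvoidsWithin U Bad X c ∧ Bad e c} : ℝ) * Fintype.card K
      ≤ w e * avoidingCount U Bad X := by
  obtain ⟨A, hAU, hpA, hA⟩ := hrec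
  obtain hK | hK := isEmpty_or_nonempty K
  · rw [Fintype.card_eq_zero, Nat.cast_zero, mul_zero]
    exact mul_nonneg hw (Nat.cast_nonneg _)
  have hcard : #A = #(A.erase p) + 1 := (card_erase_add_one hpA).symm
  have hAX : A.erase p ⊆ X := by
    rw [← subset_insert_iff]
    exact hAU.trans heX
  have hmono : (#{c : V → K | AvoidsWithin U Bad X c ∧ Bad e c} : ℝ)
      ≤ #{c : V → K | AvoidsWithin U Bad (X \ A) c ∧ Bad e c} := by
    gcongr with c
    exact fun h f hf ↦ h f (hf.trans sdiff_subset)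
  have haverage : (#{c : V → K | AvoidsWithin U Bad (X \ A) c ∧ Bad e c} : ℝ)
      * Fintype.card K ^ #A ≤ w e * β ^ #(A.erase p) * avoidingCount U Bad (X \ A) := by
    refine card_filter_and_mul_pow_le A (fun c c' hc' hc f hf hbad ↦ hc f hf ?_) hA
    exact hloc f c' c (fun v hv ↦ mem_recolourings.mp hc' v (mem_sdiff.mp (hf hv)).2) hbad
  have hgrow : β ^ #(A.erase p) * avoidingCount U Bad (X \ A)
      ≤ Fintype.card K ^ #(A.erase p) * avoidingCount U Bad X := by
    have hsplit : X \ A ∪ A.erase p = X := by grind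
    have := pow_mul_avoidingCount_le hβ.le hX (X \ A) (A.erase p)
      (disjoint_sdiff_self_left.mono_right (erase_subset p A)) hsplit.subset
    rwa [hsplit] at this
  have hK : (0 : ℝ) < Fintype.card K ^ #(A.erase p) := by positivity
  refine le_of_mul_le_mul_right ?_ hK
  calc _ ≤ #{c : V → K | AvoidsWithin U Bad (X \ A) c ∧ Bad e c} * (Fintype.card K : ℝ)
        * Fintype.card K ^ #(A.erase p) := by gcongr
    _ ≤ w e * (β ^ #(A.erase p) * avoidingCount U Bad (X \ A)) := by
        rw [mul_assoc, ← pow_succ', ← hcard, ← mul_assoc]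
        exact haverage
    _ ≤ w e * (Fintype.card K ^ #(A.erase p) * avoidingCount U Bad X) := by gcongr
    _ = _ := by ring

lemma avoidingCount_le_insert_add [Fintype E] (p : V) :
    avoidingCount U Bad X ≤ avoidingCount U Bad (insert p X)
      + ∑ e with p ∈ U e ∧ U e ⊆ insert p X,
        (#{c : V → K | AvoidsWithin U Bad X c ∧ Bad e c} : ℝ) := by
  unfold avoidingCount
  norm_cast
  refine (card_le_card fun c hc ↦ ?_).trans
    ((card_union_le _ _).trans (Nat.add_le_add_left card_biUnion_le _))
  simp only [mem_filter, mem_univ, true_and, mem_union, mem_biUnion] at hc ⊢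
  by_contra! hcon
  obtain ⟨hoccurs, hnot⟩ := hcon
  simp only [AvoidsWithin, not_forall, not_not] at hoccurs
  obtain ⟨e, heX, hbad⟩ := hoccurs
  have hpe : p ∈ U e := by
    by_contra hpe
    exact hc e ((subset_insert_iff_of_notMem hpe).mp heX) hbad
  exact hnot e ⟨hpe, heX⟩ hc hbad

variable [Fintype E]

lemma mul_avoidingCount_le (hβ : 0 < β) (hw : ∀ e, 0 ≤ w e)
    (hloc : ∀ e c c', (∀ v ∈ U e, c v = c' v) → Bad e c → Bad e c')
    (hrec : ∀ e, ∀ p ∈ U e, ∃ A ⊆ U e, p ∈ A ∧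
      ∀ c, (#{c' ∈ recolourings A c | Bad e c'} : ℝ) ≤ w e * β ^ #(A.erase p))
    (hbudget : ∀ p, β + ∑ e with p ∈ U e, w e ≤ Fintype.card K) {p : V} (hp : p ∉ X) :
    β * avoidingCount U Bad X ≤ Fintype.card K * avoidingCount U Bad (insert p X) := by
  induction X using Finset.strongInduction generalizing p with
  | H X ih =>
  have hX0 : 0 ≤ avoidingCount U Bad X := Nat.cast_nonneg _
  have hlost : ∑ e with p ∈ U e ∧ U e ⊆ insert p X,
        (#{c : V → K | AvoidsWithin U Bad X c ∧ Bad e c} : ℝ) * Fintype.card K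
      ≤ (∑ e with p ∈ U e, w e) * avoidingCount U Bad X := by
    calc _ ≤ ∑ e with p ∈ U e ∧ U e ⊆ insert p X, w e * avoidingCount U Bad X := by
          refine sum_le_sum fun e he ↦ ?_
          obtain ⟨hpe, heX⟩ := (mem_filter.mp he).2
          exact card_avoiding_and_bad_mul_le hβ hloc (fun Y hY q hq ↦ ih Y hY hq) hp (hw e) heX
            (hrec e p hpe)
      _ ≤ ∑ e with p ∈ U e, w e * avoidingCount U Bad X := by
          refine sum_le_sum_of_subset_of_nonneg (fun e he ↦ ?_)
            fun e _ _ ↦ mul_nonneg (hw e) hX0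
          simp only [mem_filter, mem_univ, true_and] at he ⊢
          exact he.1
      _ = _ := (sum_mul _ _ _).symm
  have hcover := avoidingCount_le_insert_add (U := U) (Bad := Bad) (X := X) p
  rw [← sum_mul] at hlost
  have := mul_le_mul_of_nonneg_right (hbudget p) hX0
  have := mul_le_mul_of_nonneg_left hcover (Nat.cast_nonneg (α := ℝ) (Fintype.card K))
  linarith

/-- The weighted form of Rosenfeld's counting argument for the Lovász local lemma: if the weights of
the events through any one point leave `β` of the colours, then colouring one more point multiplies
the number of good colourings by at least `β`. -/
theorem exists_colouring_avoiding (hβ : 0 < β) (hw : ∀ e, 0 ≤ w e)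
    (hloc : ∀ e c c', (∀ v ∈ U e, c v = c' v) → Bad e c → Bad e c')
    (hrec : ∀ e, ∀ p ∈ U e, ∃ A ⊆ U e, p ∈ A ∧
      ∀ c, (#{c' ∈ recolourings A c | Bad e c'} : ℝ) ≤ w e * β ^ #(A.erase p))
    (hbudget : ∀ p, β + ∑ e with p ∈ U e, w e ≤ Fintype.card K)
    (hne : ∀ e c, Bad e c → (U e).Nonempty) :
    ∃ c, ∀ e, ¬ Bad e c := by
  obtain hV | ⟨⟨p₀⟩⟩ := isEmpty_or_nonempty V
  · exact ⟨isEmptyElim, fun e hbad ↦ isEmptyElim (hne e _ hbad).choose⟩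
  have hK : (0 : ℝ) < Fintype.card K :=
    (add_pos_of_pos_of_nonneg hβ (sum_nonneg fun e _ ↦ hw e)).trans_le (hbudget p₀)
  have : Nonempty K := Fintype.card_pos_iff.mp (by exact_mod_cast hK)
  have hempty : 0 < avoidingCount U Bad ∅ := by
    unfold avoidingCount
    norm_cast
    refine card_pos.mpr ⟨fun _ ↦ Classical.arbitrary K, ?_⟩
    exact mem_filter.mpr ⟨mem_univ _, fun e he hbad ↦
      (hne e _ hbad).ne_empty (subset_empty.mp he)⟩
  have huniv : 0 < avoidingCount U Bad univ := by
    have hgrow := pow_mul_avoidingCount_le (X := univ) hβ.le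
      (fun X _ p hp ↦ mul_avoidingCount_le hβ hw hloc hrec hbudget hp) ∅ univ
      (disjoint_empty_left _) (subset_univ _)
    rw [empty_union] at hgrow
    exact pos_of_mul_pos_right ((by positivity : (0 : ℝ) < _).trans_le hgrow) (by positivity)
  unfold avoidingCount at huniv
  norm_cast at huniv
  obtain ⟨c, hc⟩ := card_pos.mp huniv
  exact ⟨c, fun e ↦ (mem_filter.mp hc).2 e (subset_univ _)⟩

end LocalLemma

section FirstMoment

open scoped Nat

/-- The number of ordered pairs of distinct lines in a projective plane of order `n`. -/
def linePairCount (n : ℕ) : ℕ :=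
  (n ^ 2 + n + 1) * (n ^ 2 + n)

/-- The numerical condition under which a uniformly random colouring with `k` colours of the points
of a plane of order `n` has fewer than one pair of lines of equal types in expectation. After
deleting their intersection the lines of a pair have `n` points each, and any prescribed type occurs
there with probability at most `n! / (k ^ n * balancedFactorialProd k n)`. The factor `2` accounts
for the two orderings of a pair. -/
def FirstMomentCond (n k : ℕ) : Prop :=
  linePairCount n * n ! < 2 * (k ^ n * balancedFactorialProd k n)

instance (n k : ℕ) : Decidable (FirstMomentCond n k) :=
  inferInstanceAs (Decidable (_ < _))

lemma FirstMomentCond.pos {n k : ℕ} (h : FirstMomentCond n k) (hn : n ≠ 0) : 0 < k := by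
  refine Nat.pos_of_ne_zero ?_
  rintro rfl
  simp [FirstMomentCond, hn] at h

lemma linePairCount_mono : Monotone linePairCount := fun m n h ↦ by
  unfold linePairCount
  gcongr

lemma balancedFactorialProd_mul_succ (k q : ℕ) :
    balancedFactorialProd k (k * (q + 1)) = balancedFactorialProd k (k * q) * (q + 1) ^ k := by
  rw [mul_add_one, balancedFactorialProd, Finset.prod_range_add, ← balancedFactorialProd]
  congr 1
  rw [Finset.prod_congr rfl fun j hj ↦ ?_, Finset.prod_const, Finset.card_range]
  have hj := Finset.mem_range.mp hj
  rw [Nat.mul_add_div (Nat.zero_lt_of_lt hj), Nat.div_eq_of_lt hj, add_zero]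

lemma balancedFactorialProd_mul (k q : ℕ) : balancedFactorialProd k (k * q) = q ! ^ k := by
  induction q with
  | zero => simp [balancedFactorialProd]
  | succ q ih => rw [balancedFactorialProd_mul_succ, ih, Nat.factorial_succ, mul_pow, mul_comm]

lemma linePairCount_mul_factorial_lt {k q₀ q : ℕ} (hk : 0 < k)
    (hbase : linePairCount (k * q₀ + (k - 1)) * (k * q₀)! < 2 * (k ^ (k * q₀) * q₀ ! ^ k))
    (hstep : ∀ q ≥ q₀, (k * q + 1).ascFactorial k * linePairCount (k * (q + 1) + (k - 1))
      ≤ (k * (q + 1)) ^ k * linePairCount (k * q + (k - 1)))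
    (hq : q₀ ≤ q) : linePairCount (k * q + (k - 1)) * (k * q)!
      < 2 * (k ^ (k * q) * balancedFactorialProd k (k * q)) := by
  induction q, hq using Nat.le_induction with
  | base => rwa [balancedFactorialProd_mul]
  | succ q hq ih =>
    calc linePairCount (k * (q + 1) + (k - 1)) * (k * (q + 1))!
        = (k * q)!
          * ((k * q + 1).ascFactorial k * linePairCount (k * (q + 1) + (k - 1))) := by
          rw [mul_add_one k q, ← Nat.factorial_mul_ascFactorial]
          ring
      _ ≤ (k * q)! * ((k * (q + 1)) ^ k * linePairCount (k * q + (k - 1))) :=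
          Nat.mul_le_mul_left _ (hstep q hq)
      _ = (k * (q + 1)) ^ k * (linePairCount (k * q + (k - 1)) * (k * q)!) := by ring
      _ < (k * (q + 1)) ^ k * (2 * (k ^ (k * q) * balancedFactorialProd k (k * q))) :=
          Nat.mul_lt_mul_of_pos_left ih (by positivity)
      _ = _ := by
          rw [balancedFactorialProd_mul_succ, mul_pow, mul_add_one k q, pow_add]
          ring

/-- Comparing `n` with the multiple of `k` below it reduces the condition to multiples of `k`, at
the price of replacing `n` by the last number of its block in the number of pairs. -/
lemma firstMomentCond_of_blocks {k q₀ n : ℕ} (hk : 0 < k)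
    (hbase : linePairCount (k * q₀ + (k - 1)) * (k * q₀)! < 2 * (k ^ (k * q₀) * q₀ ! ^ k))
    (hstep : ∀ q ≥ q₀, (k * q + 1).ascFactorial k * linePairCount (k * (q + 1) + (k - 1))
      ≤ (k * (q + 1)) ^ k * linePairCount (k * q + (k - 1)))
    (hn : k * q₀ ≤ n) : FirstMomentCond n k := by
  have hq : q₀ ≤ n / k := (Nat.le_div_iff_mul_le hk).mpr (by rwa [mul_comm])
  have hle : n ≤ k * (n / k) + (k - 1) := by
    have := Nat.lt_mul_div_succ n hk
    rw [mul_add_one] at this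
    lia
  refine lt_of_mul_lt_mul_right (a := k ^ (k * (n / k)) * balancedFactorialProd k (k * (n / k))) ?_
    (Nat.zero_le _)
  calc _ = linePairCount n
          * (n ! * (k ^ (k * (n / k)) * balancedFactorialProd k (k * (n / k)))) := by ring
    _ ≤ linePairCount (k * (n / k) + (k - 1))
          * ((k * (n / k))! * (k ^ n * balancedFactorialProd k n)) :=
        Nat.mul_le_mul (linePairCount_mono hle)
          (factorial_mul_balancedFactorialProd_le hk (Nat.mul_div_le n k))
    _ = linePairCount (k * (n / k) + (k - 1)) * (k * (n / k))!
          * (k ^ n * balancedFactorialProd k n) := by ring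
    _ < 2 * (k ^ (k * (n / k)) * balancedFactorialProd k (k * (n / k)))
          * (k ^ n * balancedFactorialProd k n) :=
        Nat.mul_lt_mul_of_pos_right (linePairCount_mul_factorial_lt hk hbase hstep hq)
          (Nat.mul_pos (pow_pos hk n) (balancedFactorialProd_pos k n))
    _ = _ := by ring

lemma firstMomentCond_eight {n : ℕ} (hn : 2 ≤ n) (hn' : n ≤ 3) : FirstMomentCond n 8 := by
  interval_cases n <;> decide +kernel

set_option exponentiation.threshold 500 in
lemma firstMomentCond_ten {n : ℕ} (hn : n ∈ Set.Icc 4 6 ∪ Set.Ici 400) :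
    FirstMomentCond n 10 := by
  obtain ⟨h4, h6⟩ | hlarge := hn
  · interval_cases n <;> decide +kernel
  refine firstMomentCond_of_blocks (q₀ := 40) (by norm_num) (by decide +kernel) (fun q hq ↦ ?_)
    hlarge
  obtain ⟨x, rfl⟩ := Nat.exists_eq_add_of_le hq
  simp only [Nat.ascFactorial_eq_prod_range, Finset.prod_range_succ, Finset.prod_range_zero,
    linePairCount]
  zify
  rw [← sub_nonneg]
  ring_nf
  positivity

lemma firstMomentCond_twelve {n : ℕ} (hn : 7 ≤ n) : FirstMomentCond n 12 := by
  obtain hsmall | hlarge := lt_or_ge n 36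
  · interval_cases n <;> decide +kernel
  refine firstMomentCond_of_blocks (q₀ := 3) (by norm_num) (by decide +kernel) (fun q hq ↦ ?_)
    hlarge
  obtain ⟨x, rfl⟩ := Nat.exists_eq_add_of_le hq
  simp only [Nat.ascFactorial_eq_prod_range, Finset.prod_range_succ, Finset.prod_range_zero,
    linePairCount]
  zify
  rw [← sub_nonneg]
  ring_nf
  positivity

end FirstMoment

section Entropy

open scoped Nat

/-- The number whose infimum over `m ≥ 2` is `entropyBound a b`. -/
noncomputable def entropyTerm (a b m : ℕ) : ℝ :=
  (m : ℝ) / ((m : ℝ) - 1) * ((m ! : ℝ) * (a : ℝ) * (b : ℝ) * ((m : ℝ) - 1)) ^ (1 / (m : ℝ))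

/-- The condition that `entropyTerm a b (r + 1) ≤ k`, where `D = a * b` (see
`entropyTerm_le_iff`), cleared of denominators and roots. The parameter is `r = m - 1`, so that no
subtraction occurs. -/
def EntropyCond (k D r : ℕ) : Prop :=
  D * (r + 1)! * (r + 1) ^ (r + 1) ≤ r ^ r * k ^ (r + 1)

lemma entropyTerm_le_iff {a b r : ℕ} (hr : 0 < r) {x : ℝ} (hx : 0 ≤ x) :
    entropyTerm a b (r + 1) ≤ x ↔
      ((a * b : ℕ) : ℝ) * (r + 1)! * (r + 1) ^ (r + 1) ≤ r ^ r * x ^ (r + 1) := by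
  have hr' : (0 : ℝ) < r := by exact_mod_cast hr
  have hroot : entropyTerm a b (r + 1) ≤ x ↔
      ((r + 1)! : ℝ) * a * b * r ≤ (r * x / (r + 1)) ^ (r + 1) := by
    rw [entropyTerm, Nat.cast_add_one, add_sub_cancel_right, div_mul_eq_mul_div, div_le_iff₀ hr',
      ← le_div_iff₀' (by positivity), mul_comm x, one_div,
      Real.rpow_inv_le_iff_of_pos (by positivity) (by positivity) (by positivity)]
    norm_cast
  refine Iff.trans ?_ (mul_le_mul_iff_left₀ hr')
  rw [hroot, div_pow, le_div_iff₀ (by positivity)]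
  push_cast
  ring_nf

lemma tendsto_entropyTerm {a b : ℕ} (hab : 0 < a * b) :
    Filter.Tendsto (entropyTerm a b) Filter.atTop Filter.atTop := by
  refine Filter.tendsto_atTop.mpr fun x ↦ ?_
  have hfact := (FloorSemiring.tendsto_pow_div_factorial_atTop |x|).eventually_lt_const one_pos
  filter_upwards [hfact, Filter.eventually_gt_atTop 1] with m hm hm1
  obtain ⟨r, rfl⟩ := Nat.exists_eq_add_of_le' hm1.le
  have hr : 0 < r := Nat.lt_of_succ_lt_succ hm1
  rw [div_lt_one (by positivity)] at hm
  by_contra! hlt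
  have hle := (entropyTerm_le_iff hr (abs_nonneg x)).mp (hlt.le.trans (le_abs_self x))
  refine hle.not_gt ?_
  calc (r : ℝ) ^ r * |x| ^ (r + 1) < r ^ r * (r + 1)! := by gcongr
    _ ≤ 1 * (r + 1)! * (r + 1) ^ (r + 1) := by
        rw [one_mul, mul_comm]
        gcongr
        exact (pow_le_pow_left₀ r.cast_nonneg (by linarith) r).trans
          (pow_le_pow_right₀ (by simp) r.le_succ)
    _ ≤ ((a * b : ℕ) : ℝ) * (r + 1)! * (r + 1) ^ (r + 1) := by
        gcongr
        exact_mod_cast hab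

lemma exists_entropyCond {a b k : ℕ} (h : ⌈entropyBound a b⌉₊ ≤ k) :
    ∃ r > 0, EntropyCond k (a * b) r := by
  obtain hab | hab := Nat.eq_zero_or_pos (a * b)
  · exact ⟨1, one_pos, by simp [EntropyCond, hab]⟩
  obtain ⟨m, hm, hmin⟩ := Filter.Tendsto.exists_within_forall_le
    (s := {m : ℕ | 2 ≤ m}) ⟨2, le_refl 2⟩ (Nat.cofinite_eq_atTop ▸ tendsto_entropyTerm hab)
  obtain ⟨r, rfl⟩ := Nat.exists_eq_add_of_le' (Nat.one_le_of_lt hm)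
  have hinf : entropyBound a b = entropyTerm a b (r + 1) :=
    IsLeast.csInf_eq ⟨⟨_, hm, rfl⟩, Set.forall_mem_image.mpr fun _ ↦ hmin _⟩
  have hr : 0 < r := Nat.lt_of_succ_lt_succ hm
  have hk := hinf ▸ Nat.ceil_le.mp h
  exact ⟨r, hr, by exact_mod_cast (entropyTerm_le_iff hr (Nat.cast_nonneg k)).mp hk⟩

lemma EntropyCond.mono {k k' D r : ℕ} (h : EntropyCond k D r) (hk : k ≤ k') :
    EntropyCond k' D r :=
  h.trans (by gcongr)

lemma succ_pow_le_pow_mul_pow (r : ℕ) : (r + 1) ^ (2 * r + 1) ≤ r ^ r * (r + 2) ^ (r + 1) := by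
  obtain rfl | hr := Nat.eq_zero_or_pos r
  · norm_num
  have hinv : 1 / (r + 1 : ℝ) ^ 2 ≤ 1 := by
    rw [div_le_one (by positivity)]
    exact one_le_pow₀ (by simp)
  have hbernoulli : 1 - 1 / (r + 1 : ℝ) ≤ (1 - 1 / (r + 1 : ℝ) ^ 2) ^ (r + 1) := by
    calc 1 - 1 / (r + 1 : ℝ) = 1 + (r + 1 : ℕ) * -(1 / (r + 1 : ℝ) ^ 2) := by
          push_cast
          field_simp
          ring
      _ ≤ (1 - 1 / (r + 1 : ℝ) ^ 2) ^ (r + 1) := one_add_mul_le_pow (by linarith) _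
  have hmul : (r : ℝ) * (r + 1) ^ (2 * r + 1) ≤ r * (r ^ r * (r + 2) ^ (r + 1)) := by
    calc (r : ℝ) * (r + 1) ^ (2 * r + 1)
        = (1 - 1 / (r + 1 : ℝ)) * (r + 1) * (r + 1) ^ (2 * r + 1) := by
          congr 1
          field_simp
          ring
      _ = (1 - 1 / (r + 1 : ℝ)) * ((r + 1) ^ 2) ^ (r + 1) := by
          rw [mul_assoc, ← pow_succ', ← pow_mul, mul_add_one 2 r]
      _ ≤ (1 - 1 / (r + 1 : ℝ) ^ 2) ^ (r + 1) * ((r + 1) ^ 2) ^ (r + 1) := by gcongr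
      _ = (r * (r + 2)) ^ (r + 1) := by
          rw [← mul_pow]
          congr 1
          field_simp
          ring
      _ = r * (r ^ r * (r + 2) ^ (r + 1)) := by
          rw [mul_pow]
          ring
  exact Nat.le_of_mul_le_mul_left (by exact_mod_cast hmul) hr

lemma EntropyCond.of_succ {k D r : ℕ} (hk : k * (r + 1) ≤ (r + 2) ^ 2)
    (h : EntropyCond k D (r + 1)) : EntropyCond k D r := by
  refine Nat.le_of_mul_le_mul_right (c := (r + 2) ^ (r + 3)) ?_ (by positivity)
  calc D * (r + 1)! * (r + 1) ^ (r + 1) * (r + 2) ^ (r + 3)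
      = (D * (r + 2)! * (r + 2) ^ (r + 2)) * (r + 1) ^ (r + 1) := by
        rw [Nat.factorial_succ (r + 1)]
        ring
    _ ≤ (r + 1) ^ (r + 1) * k ^ (r + 2) * (r + 1) ^ (r + 1) := Nat.mul_le_mul_right _ h
    _ = (r + 1) ^ (2 * r + 1) * (k * (r + 1)) * k ^ (r + 1) := by ring
    _ ≤ (r ^ r * (r + 2) ^ (r + 1)) * (r + 2) ^ 2 * k ^ (r + 1) := by
        gcongr
        exact succ_pow_le_pow_mul_pow r
    _ = r ^ r * k ^ (r + 1) * (r + 2) ^ (r + 3) := by ring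

lemma EntropyCond.exists_le {k D r : ℕ} (r₀ : ℕ) (hk : k ≤ r₀ + 3) (hr : 0 < r) (hr₀ : 0 < r₀)
    (h : EntropyCond k D r) : ∃ r', 0 < r' ∧ r' ≤ r₀ ∧ EntropyCond k D r' := by
  obtain hle | hle := le_total r r₀
  · exact ⟨r, hr, hle, h⟩
  refine ⟨r₀, hr₀, le_rfl, ?_⟩
  induction r, hle using Nat.le_induction with
  | base => exact h
  | succ r hle ih =>
    refine ih (hr₀.trans_le hle) (h.of_succ ?_)
    calc k * (r + 1) ≤ (r + 3) * (r + 1) := Nat.mul_le_mul_right _ (by lia)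
      _ ≤ (r + 2) ^ 2 := by nlinarith

lemma EntropyCond.eight_le {k D r : ℕ} (h : EntropyCond k D r) (hr : 0 < r) (hD : 12 ≤ D) :
    8 ≤ k := by
  by_contra! hk
  obtain ⟨s, hs, hs', h⟩ := (h.mono (Nat.le_of_lt_succ hk)).exists_le 4 le_rfl hr four_pos
  interval_cases s <;> norm_num [EntropyCond, Nat.factorial] at h <;> lia

lemma EntropyCond.ten_le {k D r : ℕ} (h : EntropyCond k D r) (hr : 0 < r) (hD : 54 ≤ D) :
    10 ≤ k := by
  by_contra! hk
  obtain ⟨s, hs, hs', h⟩ := (h.mono (Nat.le_of_lt_succ hk)).exists_le 6 le_rfl hr (by norm_num)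
  interval_cases s <;> norm_num [EntropyCond, Nat.factorial] at h <;> lia

lemma EntropyCond.twelve_le {k D r : ℕ} (h : EntropyCond k D r) (hr : 0 < r) (hD : 282 ≤ D) :
    12 ≤ k := by
  by_contra! hk
  obtain ⟨s, hs, hs', h⟩ := (h.mono (Nat.le_of_lt_succ hk)).exists_le 8 le_rfl hr (by norm_num)
  interval_cases s <;> norm_num [EntropyCond, Nat.factorial] at h <;> lia

end Entropy

section Plane

open Finset Classical
open scoped Nat

section LineType

variable {P L : Type*} [Membership P L]

lemma IsLegitimate.castLE {k k' : ℕ} {f : P → Fin k} (hf : IsLegitimate L f) (h : k ≤ k') :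
    IsLegitimate L fun p ↦ Fin.castLE h (f p) := by
  refine fun l₁ l₂ hne heq ↦ hf l₁ l₂ hne (funext fun i ↦ ?_)
  simpa only [lineType, Fin.castLE_inj] using congrFun heq (Fin.castLE h i)

variable [Fintype P]

lemma lineType_eq_card {k : ℕ} (f : P → Fin k) (l : L) (i : Fin k) :
    lineType f l i = #{p | p ∈ l ∧ f p = i} := by
  rw [lineType, Set.ncard_eq_toFinset_card', Set.toFinset_ofPred]

lemma card_recolourings_lineType_eq_mul_le {k : ℕ} {A : Finset P} {l₁ l₂ : L}
    (hA : ∀ p ∈ A, p ∈ l₁ ∧ p ∉ l₂) (c : P → Fin k) :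
    #{c' ∈ recolourings A c | lineType c' l₁ = lineType c' l₂} * balancedFactorialProd k #A
      ≤ (#A)! := by
  have hcount := card_recolourings_fibre_cards_mul_le A c
    fun i ↦ lineType c l₂ i - #{p | p ∈ l₁ ∧ p ∉ A ∧ c p = i}
  rw [Fintype.card_fin] at hcount
  refine (Nat.mul_le_mul_right _ (card_le_card fun c' hc' ↦ ?_)).trans hcount
  simp only [mem_filter, mem_recolourings] at hc' ⊢
  obtain ⟨hoff, htype⟩ := hc'
  refine ⟨hoff, fun i ↦ ?_⟩
  have h₂ : lineType c' l₂ i = lineType c l₂ i := by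
    rw [lineType_eq_card, lineType_eq_card]
    congr 1
    refine filter_congr fun p _ ↦ and_congr_right fun hp ↦ ?_
    rw [hoff p fun hpA ↦ (hA p hpA).2 hp]
  have h₁ : lineType c' l₁ i = #{v ∈ A | c' v = i} + #{p | p ∈ l₁ ∧ p ∉ A ∧ c p = i} := by
    rw [lineType_eq_card, ← card_union_of_disjoint (by grind [Finset.disjoint_left])]
    congr 1
    ext p
    have := hA p
    have := hoff p
    grind
  rw [← h₂, ← htype, h₁, Nat.add_sub_cancel]

end LineType

variable {P L : Type*} [Membership P L]

section Incidence

variable [ProjectivePlane P L]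

variable (L) in
lemma card_linesThrough [Finite P] [Fintype L] (p : P) :
    #{l : L | p ∈ l} = ProjectivePlane.order P L + 1 := by
  rw [← ProjectivePlane.lineCount_eq L p, lineCount, Nat.card_eq_fintype_card, Fintype.card_subtype]

variable (P) in
lemma card_pointsOn [Fintype P] [Finite L] (l : L) :
    #{p : P | p ∈ l} = ProjectivePlane.order P L + 1 := by
  rw [← ProjectivePlane.pointCount_eq P l, pointCount, Nat.card_eq_fintype_card,
    Fintype.card_subtype]

lemma card_linesThrough_two [Fintype L] {p q : P} (h : p ≠ q) : #{l : L | p ∈ l ∧ q ∈ l} = 1 := by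
  obtain ⟨hp, hq⟩ := HasLines.mkLine_ax (L := L) h
  refine card_eq_one.mpr ⟨HasLines.mkLine h, eq_singleton_iff_unique_mem.mpr ⟨by simp [hp, hq], ?_⟩⟩
  simp only [mem_filter, mem_univ, true_and]
  exact fun l hl ↦ (Nondegenerate.eq_or_eq hl.1 hl.2 hp hq).resolve_left h

lemma card_commonPoints [Fintype P] {l₁ l₂ : L} (h : l₁ ≠ l₂) :
    #{p : P | p ∈ l₁ ∧ p ∈ l₂} = 1 := by
  obtain ⟨h₁, h₂⟩ := HasPoints.mkPoint_ax (P := P) h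
  refine card_eq_one.mpr
    ⟨HasPoints.mkPoint h, eq_singleton_iff_unique_mem.mpr ⟨by simp [h₁, h₂], ?_⟩⟩
  simp only [mem_filter, mem_univ, true_and]
  exact fun p hp ↦ (Nondegenerate.eq_or_eq hp.1 h₁ hp.2 h₂).resolve_right h

lemma card_le_card_diff_add_one [Fintype P] (S : Set P) {l₁ l₂ : L} (h : l₁ ≠ l₂) :
    #{p | p ∈ S ∧ p ∈ l₁} ≤ #{p | p ∈ S ∧ p ∈ l₁ ∧ p ∉ l₂} + 1 := by
  rw [← card_commonPoints (P := P) h]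
  refine (card_le_card fun p hp ↦ ?_).trans (card_union_le _ _)
  grind

end Incidence

section FirstMomentMethod

lemma two_le_card_lineType_eq [Fintype L] {k : ℕ} {c : P → Fin k} (hc : ¬ IsLegitimate L c) :
    2 ≤ #{e ∈ (univ : Finset L).offDiag | lineType c e.1 = lineType c e.2} := by
  simp only [IsLegitimate, not_forall, not_not, ne_eq] at hc
  obtain ⟨l₁, l₂, hne, heq⟩ := hc
  rw [← card_pair (a := (l₁, l₂)) (b := (l₂, l₁)) (by simp [hne])]
  refine card_le_card fun _ he ↦ ?_
  obtain rfl | rfl := mem_insert.mp he |>.imp_right mem_singleton.mp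
  · simp [hne, heq]
  · simp [Ne.symm hne, heq]

variable [ProjectivePlane P L]

lemma card_lineType_eq_mul_le [Fintype P] [Finite L] {n k : ℕ} (hn : ProjectivePlane.order P L = n)
    {l₁ l₂ : L} (h : l₁ ≠ l₂) :
    #{c : P → Fin k | lineType c l₁ = lineType c l₂} * (k ^ n * balancedFactorialProd k n)
      ≤ n ! * k ^ Fintype.card P := by
  obtain ⟨A, hA, hcard⟩ : ∃ A : Finset P, (∀ p ∈ A, p ∈ l₁ ∧ p ∉ l₂) ∧ #A = n := by
    have hle := card_le_card_diff_add_one (Set.univ : Set P) h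
    simp only [Set.mem_univ, true_and, card_pointsOn, hn, add_le_add_iff_right] at hle
    obtain ⟨A, hA, hcard⟩ := exists_subset_card_eq hle
    exact ⟨A, fun p hp ↦ by simpa using hA hp, hcard⟩
  have hpos : (0 : ℝ) < balancedFactorialProd k n := by
    exact_mod_cast balancedFactorialProd_pos k n
  have haverage := card_filter_and_mul_pow_le A (G := fun _ : P → Fin k ↦ True)
    (Bad := fun c ↦ lineType c l₁ = lineType c l₂) (B := n ! / balancedFactorialProd k n)
    (fun _ _ _ ↦ id) fun c ↦ by
      rw [le_div_iff₀ hpos, ← hcard]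
      convert (Nat.cast_le (α := ℝ)).mpr (card_recolourings_lineType_eq_mul_le hA c)
      push_cast
      congr!
  simp only [true_and, filter_true, card_univ, Fintype.card_fun, Fintype.card_fin, hcard]
    at haverage
  rw [div_mul_eq_mul_div, le_div_iff₀ hpos, mul_assoc] at haverage
  exact_mod_cast haverage

theorem exists_isLegitimate_of_firstMomentCond [Finite P] [Finite L] {n k : ℕ}
    (hn : ProjectivePlane.order P L = n) (h : FirstMomentCond n k) :
    ∃ f : P → Fin k, IsLegitimate L f := by
  have := Fintype.ofFinite L
  have := Fintype.ofFinite P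
  have hk : 0 < k := by
    refine h.pos ?_
    have := ProjectivePlane.one_lt_order P L
    lia
  by_contra! hcon
  have hcount : k ^ Fintype.card P * 2
      ≤ ∑ e ∈ (univ : Finset L).offDiag, #{c : P → Fin k | lineType c e.1 = lineType c e.2} := by
    calc _ = ∑ _c : P → Fin k, 2 := by simp
      _ ≤ _ := sum_le_sum fun c _ ↦ two_le_card_lineType_eq (hcon c)
      _ = _ := sum_card_bipartiteAbove_eq_sum_card_bipartiteBelow
        fun (c : P → Fin k) (e : L × L) ↦ lineType c e.1 = lineType c e.2
  have hpairs : #(univ : Finset L).offDiag = linePairCount n := by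
    rw [offDiag_card, card_univ, ProjectivePlane.card_lines P L, hn, ← Nat.mul_sub_one]
    rfl
  refine h.not_ge (Nat.le_of_mul_le_mul_right ?_ (pow_pos hk (Fintype.card P)))
  calc 2 * (k ^ n * balancedFactorialProd k n) * k ^ Fintype.card P
      = k ^ Fintype.card P * 2 * (k ^ n * balancedFactorialProd k n) := by ring
    _ ≤ (∑ e ∈ (univ : Finset L).offDiag, #{c : P → Fin k | lineType c e.1 = lineType c e.2})
          * (k ^ n * balancedFactorialProd k n) := Nat.mul_le_mul_right _ hcount
    _ ≤ ∑ e ∈ (univ : Finset L).offDiag, n ! * k ^ Fintype.card P := by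
        rw [sum_mul]
        exact sum_le_sum fun _ he ↦ card_lineType_eq_mul_le hn (mem_offDiag.mp he).2.2
    _ = linePairCount n * n ! * k ^ Fintype.card P := by
        rw [sum_const, hpairs, smul_eq_mul, mul_assoc]

end FirstMomentMethod

end Plane

section DangerousPairs

open Finset Classical

lemma sum_abs_sub_le {ι : Type*} [Fintype ι] {x y u v : ι → ℝ} (hu : ∀ i, 0 ≤ u i)
    (hv : ∀ i, 0 ≤ v i) (h : ∀ i, x i + u i = y i + v i) :
    ∑ i, |x i - y i| ≤ ∑ i, u i + ∑ i, v i := by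
  rw [← sum_add_distrib]
  refine sum_le_sum fun i _ ↦ abs_le.mpr ⟨?_, ?_⟩ <;> linarith [h i, hu i, hv i]

variable {P L : Type*} [Membership P L] {S : Set P} {k n D : ℕ}
  {f : {p : P // p ∉ S} → Fin k} {l₁ l₂ : L}

/-- The `ℓ¹`-distance of the types of two lines with respect to a partial colouring. -/
noncomputable def typeDist (f : {p : P // p ∉ S} → Fin k) (l₁ l₂ : L) : ℝ :=
  ∑ i, |(partialLineType f l₁ i : ℝ) - partialLineType f l₂ i|

lemma isDangerousPair_iff :
    IsDangerousPair n f l₁ l₂ ↔ l₁ ≠ l₂ ∧ typeDist f l₁ l₂ ≤ 22 * Real.log n := Iff.rfl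

lemma IsDangerousPair.symm (h : IsDangerousPair n f l₁ l₂) : IsDangerousPair n f l₂ l₁ :=
  ⟨h.1.symm, by simpa only [abs_sub_comm] using h.2⟩

lemma typeDist_castLE {k' : ℕ} (h : k ≤ k') (f : {p : P // p ∉ S} → Fin k) (l₁ l₂ : L) :
    typeDist (fun p ↦ Fin.castLE h (f p)) l₁ l₂ = typeDist f l₁ l₂ := by
  refine (sum_of_injOn (Fin.castLE h) (Fin.castLE_injective h).injOn (fun _ _ ↦ by simp)
    (fun i _ hi ↦ ?_) fun i _ ↦ ?_).symm
  · have hne (p : {p : P // p ∉ S}) : Fin.castLE h (f p) ≠ i := fun hp ↦ hi ⟨f p, by simp, hp⟩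
    simp [partialLineType, hne]
  · simp only [partialLineType, Fin.castLE_inj]

lemma ColorsSuffice.mono {a b d d' : ℕ} (h : ColorsSuffice L n S a b d) (hd : d ≤ d') :
    ColorsSuffice L n S a b d' := by
  obtain ⟨f, hf⟩ := h
  refine ⟨fun p ↦ Fin.castLE hd (f p), fun p hp ↦ ?_⟩
  simpa only [dangerousPairsAt, isDangerousPair_iff, typeDist_castLE] using hf p hp

lemma IsBalancedSet.exists_mem (hS : IsBalancedSet L n S) (hn : 2 ≤ n) (l : L) :
    ∃ p ∈ S, p ∈ l := by
  have hpos : 0 < Real.log n := Real.log_pos (by exact_mod_cast hn)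
  obtain ⟨p, hpl, hpS⟩ := Set.nonempty_of_ncard_ne_zero
    (by exact_mod_cast (hpos.trans_le (hS l).1).ne')
  exact ⟨p, hpS, hpl⟩

section Counting

variable [Finite L] {p : P}

lemma card_le_ncard_dangerousPairsAt {T : Finset (L × L)}
    (hT : ∀ e ∈ T, IsDangerousPair n f e.1 e.2 ∧ p ∈ e.1)
    (hinj : Set.InjOn (fun e : L × L ↦ s(e.1, e.2)) T) :
    #T ≤ (dangerousPairsAt L n f p).ncard := by
  rw [← Set.ncard_coe_finset]
  exact Set.ncard_le_ncard_of_injOn _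
    (fun e he ↦ ⟨e.1, e.2, rfl, (hT e he).1, Or.inl (hT e he).2⟩) hinj (Set.toFinite _)

lemma ncard_isDangerousPair_le {l : L} (hl : p ∈ l) :
    {l' : L | IsDangerousPair n f l l'}.ncard ≤ (dangerousPairsAt L n f p).ncard :=
  Set.ncard_le_ncard_of_injOn (fun l' ↦ s(l, l')) (fun l' hl' ↦ ⟨l, l', rfl, hl', Or.inl hl⟩)
    (fun _ _ _ _ h ↦ Sym2.congr_right.mp h) (Set.toFinite _)

end Counting

section Balanced

variable [Fintype P]

/-- The points to which a partial colouring gives the colour `i`. -/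
noncomputable def colourClass (f : {p : P // p ∉ S} → Fin k) (i : Fin k) : Finset P :=
  ({q | f q = i} : Finset {p : P // p ∉ S}).map (.subtype _)

omit [Membership P L] in
lemma mem_colourClass {i : Fin k} {p : P} :
    p ∈ colourClass f i ↔ ∃ h : p ∉ S, f ⟨p, h⟩ = i := by
  simp [colourClass]

lemma partialLineType_eq_card (f : {p : P // p ∉ S} → Fin k) (l : L) (i : Fin k) :
    partialLineType f l i = #{p ∈ colourClass f i | p ∈ l} := by
  rw [partialLineType, Set.ncard_eq_toFinset_card', Set.toFinset_ofPred, colourClass, filter_map,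
    card_map, filter_filter]
  simp only [Function.comp_apply, Function.Embedding.subtype_apply, and_comm]
  congr!

omit [Membership P L] in
lemma sum_card_colourClass (f : {p : P // p ∉ S} → Fin k) (Q : P → Prop) :
    ∑ i, #{p ∈ colourClass f i | Q p} = #{p | p ∉ S ∧ Q p} := by
  rw [← card_biUnion fun i _ j _ hij ↦ by
    grind [Finset.disjoint_left, mem_colourClass]]
  congr 1
  ext p
  simp [mem_colourClass]

lemma lineType_eq_partialLineType_add {g : P → Fin k} (hg : ∀ q : {p : P // p ∉ S}, g q = f q)
    (l : L) (i : Fin k) :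
    lineType g l i = partialLineType f l i + #{p | (p ∈ S ∧ p ∈ l) ∧ g p = i} := by
  rw [lineType_eq_card, partialLineType_eq_card,
    ← card_union_of_disjoint (by grind [Finset.disjoint_left, mem_colourClass])]
  congr 1
  ext p
  by_cases hp : p ∈ S
  · simp [mem_colourClass, hp]
  · simp [mem_colourClass, hp, ← hg, and_comm]

lemma ncard_inter_eq_card (S : Set P) (l : L) :
    {p : P | p ∈ l ∧ p ∈ S}.ncard = #{p | p ∈ S ∧ p ∈ l} := by
  simp only [Set.ncard_eq_toFinset_card', Set.toFinset_ofPred, and_comm]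

omit [Fintype P] in
lemma IsBalancedSet.typeDist_le [Finite P] (hS : IsBalancedSet L n S) {g : P → Fin k}
    (hg : ∀ q : {p : P // p ∉ S}, g q = f q) (h : lineType g l₁ = lineType g l₂) :
    typeDist f l₁ l₂ ≤ 22 * Real.log n := by
  have := Fintype.ofFinite P
  have hsum (l : L) : ∑ i, (#{p | (p ∈ S ∧ p ∈ l) ∧ g p = i} : ℝ) ≤ 11 * Real.log n := by
    refine le_trans (le_of_eq ?_) (hS l).2
    rw [ncard_inter_eq_card, card_eq_sum_card_fiberwise (f := g) fun _ _ ↦ mem_univ _]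
    simp only [filter_filter, Nat.cast_sum]
  refine (sum_abs_sub_le (fun i ↦ Nat.cast_nonneg _) (fun i ↦ Nat.cast_nonneg _)
    fun i ↦ ?_).trans ((add_le_add (hsum l₁) (hsum l₂)).trans_eq (by ring))
  have := congrFun h i
  rw [lineType_eq_partialLineType_add hg, lineType_eq_partialLineType_add hg] at this
  exact_mod_cast this

end Balanced

section SmallOrder

variable [ProjectivePlane P L]

lemma isDangerousPair_of_le [Finite P] [Finite L] (hn : ProjectivePlane.order P L = n)
    (hS : ∀ l : L, ∃ p ∈ S, p ∈ l) (hlog : n ≤ 11 * Real.log n) (hne : l₁ ≠ l₂) :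
    IsDangerousPair n f l₁ l₂ := by
  have := Fintype.ofFinite P
  have hsum (l : L) : ∑ i, (partialLineType f l i : ℝ) ≤ 11 * Real.log n := by
    refine le_trans ?_ hlog
    rw [← Nat.cast_sum, Nat.cast_le]
    simp only [partialLineType_eq_card]
    rw [sum_card_colourClass f (· ∈ l), ← Nat.lt_succ_iff, Nat.succ_eq_add_one,
      ← hn, ← card_pointsOn P l]
    obtain ⟨p, hpS, hpl⟩ := hS l
    exact card_lt_card ⟨fun q ↦ by simp +contextual, fun h ↦ by simpa [hpS, hpl] using @h p⟩
  exact ⟨hne, (sum_abs_sub_le (fun i ↦ Nat.cast_nonneg _) (fun i ↦ Nat.cast_nonneg _)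
    fun i ↦ add_comm _ _).trans ((add_le_add (hsum l₂) (hsum l₁)).trans_eq (by ring))⟩

lemma mul_sq_le_ncard_dangerousPairsAt [Finite P] [Finite L]
    (hn : ProjectivePlane.order P L = n) (p : P)
    (hall : ∀ l₁ l₂ : L, l₁ ≠ l₂ → IsDangerousPair n f l₁ l₂) :
    (n + 1) * n ^ 2 ≤ (dangerousPairsAt L n f p).ncard := by
  have := Fintype.ofFinite L
  have hoff : #{l : L | p ∉ l} = n ^ 2 := by
    have := card_filter_add_card_filter_not (s := (univ : Finset L)) (p ∈ ·)
    rw [card_linesThrough, card_univ, ProjectivePlane.card_lines P L, hn] at this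
    lia
  rw [← hoff, ← hn, ← card_linesThrough L p, ← card_product]
  refine card_le_ncard_dangerousPairsAt (fun e he ↦ ?_) fun e he e' he' h ↦ ?_
  · simp only [mem_product, mem_filter, mem_univ, true_and] at he
    exact ⟨hn ▸ hall _ _ fun h ↦ he.2 (h ▸ he.1), he.1⟩
  · simp only [coe_product, coe_filter, mem_univ, true_and, Set.mem_prod,
      Set.mem_ofPred_eq] at he he'
    obtain ⟨h₁, h₂⟩ | ⟨h₁, -⟩ := Sym2.eq_iff.mp h
    · exact Prod.ext h₁ h₂
    · exact absurd (h₁ ▸ he.1) he'.2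

end SmallOrder

end DangerousPairs

section SecondMoment

open Finset Classical

variable {P L : Type*} [Membership P L] [ProjectivePlane P L] {n : ℕ}

section Counting

variable [Finite P] [Fintype L]

lemma sum_card_inter_line (hn : ProjectivePlane.order P L = n) (C : Finset P) :
    ∑ l : L, (#{p ∈ C | p ∈ l} : ℝ) = #C * (n + 1) := by
  have h := sum_card_bipartiteAbove_eq_sum_card_bipartiteBelow
    (s := C) (t := (univ : Finset L)) (· ∈ ·)
  simp only [bipartiteAbove, bipartiteBelow, card_linesThrough, hn, sum_const, smul_eq_mul] at h
  exact_mod_cast h.symm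

lemma sum_card_inter_line_sq (hn : ProjectivePlane.order P L = n) (C : Finset P) :
    ∑ l : L, (#{p ∈ C | p ∈ l} : ℝ) ^ 2 = #C * (#C + n) := by
  have hrow (p) (hp : p ∈ C) : ∑ q ∈ C, #{l : L | p ∈ l ∧ q ∈ l} = #C + n := by
    rw [← add_sum_erase _ _ hp, sum_congr rfl fun q hq ↦
      card_linesThrough_two (ne_of_mem_erase hq).symm, ← card_erase_add_one hp]
    simp only [and_self, card_linesThrough, hn, sum_const, smul_eq_mul, mul_one]
    lia
  have hsquare (l : L) : #{e ∈ C ×ˢ C | e.1 ∈ l ∧ e.2 ∈ l} = #{p ∈ C | p ∈ l} ^ 2 := by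
    rw [filter_product (· ∈ l) (· ∈ l), card_product, sq]
  have h := sum_card_bipartiteAbove_eq_sum_card_bipartiteBelow
    (s := C ×ˢ C) (t := (univ : Finset L)) fun e l ↦ e.1 ∈ l ∧ e.2 ∈ l
  simp only [bipartiteAbove, bipartiteBelow, hsquare, sum_product, sum_congr rfl hrow, sum_const,
    smul_eq_mul] at h
  exact_mod_cast h.symm

lemma card_lines_cast (hn : ProjectivePlane.order P L = n) :
    (Fintype.card L : ℝ) = (n : ℝ) ^ 2 + n + 1 := by
  rw [ProjectivePlane.card_lines P L, hn]
  push_cast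
  rfl

lemma sum_sq_sub_card_inter_line (hn : ProjectivePlane.order P L = n) (C : Finset P) :
    ∑ l₁ : L, ∑ l₂ : L, ((#{p ∈ C | p ∈ l₁} : ℝ) - #{p ∈ C | p ∈ l₂}) ^ 2
      = 2 * n * (#C * ((n : ℝ) ^ 2 + n + 1 - #C)) := by
  simp only [sub_sq, sum_add_distrib, sum_sub_distrib, sum_const, card_univ, nsmul_eq_mul,
    ← mul_sum, ← sum_mul, sum_card_inter_line hn, sum_card_inter_line_sq hn, card_lines_cast hn]
  ring

end Counting

variable {S : Set P} {k D : ℕ}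

lemma sum_typeDist_sq_le [Fintype P] [Fintype L] (hn : ProjectivePlane.order P L = n)
    (f : {p : P // p ∉ S} → Fin k) :
    ∑ l₁ : L, ∑ l₂ : L, typeDist f l₁ l₂ ^ 2
      ≤ 2 * n * (#{p | p ∉ S} * (k * ((n : ℝ) ^ 2 + n + 1) - #{p | p ∉ S})) := by
  have hcard : ∑ i, (#(colourClass f i) : ℝ) = #{p | p ∉ S} := by
    simpa [← Nat.cast_sum] using congrArg (Nat.cast : ℕ → ℝ) (sum_card_colourClass f fun _ ↦ True)
  have hcauchy (l₁ l₂ : L) : typeDist f l₁ l₂ ^ 2 ≤ k * ∑ i,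
      ((#{p ∈ colourClass f i | p ∈ l₁} : ℝ) - #{p ∈ colourClass f i | p ∈ l₂}) ^ 2 := by
    simpa only [typeDist, sq_abs, partialLineType_eq_card, card_univ, Fintype.card_fin] using
      sq_sum_le_card_mul_sum_sq (s := univ)
        (f := fun i ↦ |(partialLineType f l₁ i : ℝ) - partialLineType f l₂ i|)
  calc _ ≤ ∑ l₁ : L, ∑ l₂ : L, k * ∑ i,
        ((#{p ∈ colourClass f i | p ∈ l₁} : ℝ) - #{p ∈ colourClass f i | p ∈ l₂}) ^ 2 :=
        sum_le_sum fun l₁ _ ↦ sum_le_sum fun l₂ _ ↦ hcauchy l₁ l₂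
    _ = k * ∑ i, ∑ l₁ : L, ∑ l₂ : L,
        ((#{p ∈ colourClass f i | p ∈ l₁} : ℝ) - #{p ∈ colourClass f i | p ∈ l₂}) ^ 2 := by
        simp only [← mul_sum, sum_comm (t := (univ : Finset (Fin k)))]
    _ = 2 * n * (k * #{p | p ∉ S} * ((n : ℝ) ^ 2 + n + 1)
          - k * ∑ i, (#(colourClass f i) : ℝ) ^ 2) := by
        simp only [sum_sq_sub_card_inter_line hn, mul_sub, ← sq, sum_sub_distrib, ← mul_sum,
          ← sum_mul, hcard]
        ring
    _ ≤ _ := by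
        have := sq_sum_le_card_mul_sum_sq (s := univ) (f := fun i ↦ (#(colourClass f i) : ℝ))
        rw [hcard, card_univ, Fintype.card_fin] at this
        refine mul_le_mul_of_nonneg_left ?_ (by positivity)
        linarith

lemma le_sum_typeDist_sq [Finite P] [Fintype L] (hn : ProjectivePlane.order P L = n)
    (f : {p : P // p ∉ S} → Fin k)
    (hD : ∀ l : L, {l' : L | IsDangerousPair n f l l'}.ncard ≤ D) :
    ((n : ℝ) ^ 2 + n + 1) * (((n : ℝ) ^ 2 + n - D) * (22 * Real.log n) ^ 2)
      ≤ ∑ l₁ : L, ∑ l₂ : L, typeDist f l₁ l₂ ^ 2 := by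
  rw [← card_lines_cast hn, ← nsmul_eq_mul, ← card_univ]
  refine card_nsmul_le_sum _ _ _ fun l _ ↦ ?_
  have hcard : (n : ℝ) ^ 2 + n - D ≤ #{l' ∈ univ.erase l | ¬ IsDangerousPair n f l l'} := by
    have hsplit := card_filter_add_card_filter_not (s := univ.erase l) (IsDangerousPair n f l)
    have hdanger : #{l' ∈ univ.erase l | IsDangerousPair n f l l'} ≤ D := by
      refine le_trans ?_ (hD l)
      rw [← Set.ncard_coe_finset]
      exact Set.ncard_le_ncard (fun l' hl' ↦ (mem_filter.mp hl').2) (Set.toFinite _)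
    rw [card_erase_of_mem (mem_univ l), card_univ, ProjectivePlane.card_lines P L, hn] at hsplit
    rw [sub_le_iff_le_add]
    exact_mod_cast (by lia : n ^ 2 + n ≤ _ + D)
  calc _ ≤ #{l' ∈ univ.erase l | ¬ IsDangerousPair n f l l'} * (22 * Real.log n) ^ 2 := by gcongr
    _ = ∑ l' ∈ univ.erase l with ¬ IsDangerousPair n f l l', (22 * Real.log n) ^ 2 := by
        rw [sum_const, nsmul_eq_mul]
    _ ≤ ∑ l' ∈ univ.erase l with ¬ IsDangerousPair n f l l', typeDist f l l' ^ 2 := by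
        refine sum_le_sum fun l' hl' ↦ ?_
        simp only [mem_filter, mem_erase, mem_univ, isDangerousPair_iff] at hl'
        have := Real.log_natCast_nonneg n
        have : 22 * Real.log n < typeDist f l l' := by grind
        gcongr
    _ ≤ _ := sum_le_sum_of_subset_of_nonneg (subset_univ _) fun _ _ _ ↦ by positivity

section Numerics

lemma mul_le_mul_log {i j : ℕ} (h : 2 ^ j ≤ n ^ i) : j * 0.6931 ≤ i * Real.log n := by
  calc j * 0.6931 ≤ j * Real.log 2 := by
        gcongr
        linarith [Real.log_two_gt_d9]
    _ ≤ i * Real.log n := by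
        rw [← Real.log_pow, ← Real.log_pow]
        exact Real.log_le_log (by positivity) (by exact_mod_cast h)

lemma le_eleven_mul_log (hn : 2 ≤ n) (hn' : n ≤ 30) : n ≤ 11 * Real.log n := by
  obtain ⟨j, hj, hnj⟩ : ∃ j, 2 ^ j ≤ n ^ 1 ∧ 10 * n ≤ 76 * j := by
    obtain h | h | h : n ≤ 7 ∨ n ∈ Set.Icc 8 15 ∨ 16 ≤ n := by grind
    · exact ⟨1, by lia, by lia⟩
    · exact ⟨3, by grind, by grind⟩
    · exact ⟨4, by lia, by lia⟩
  have hlog := mul_le_mul_log hj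
  have hnj : (10 * n : ℝ) ≤ 76 * j := by exact_mod_cast hnj
  push_cast at hlog
  linarith [Nat.cast_nonneg (α := ℝ) j]

lemma mul_lt_sub_mul_of_le {a b q x₀ x : ℝ} (hb : 0 ≤ b) (hq : 0 ≤ q) (hx₀ : 0 ≤ x₀)
    (hx : x₀ ≤ x) (h : a * x₀ < (x₀ - q) * b) : a * x < (x - q) * b := by
  have hab : a ≤ b := by
    by_contra! hba
    nlinarith [mul_le_mul_of_nonneg_right hba.le hx₀, mul_nonneg hq hb]
  nlinarith [mul_le_mul_of_nonneg_right hab (sub_nonneg.mpr hx)]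

lemma second_moment_lt_of_mem_Icc {lo hi i j : ℕ} (hn : n ∈ Set.Icc lo hi) (hi₀ : 0 < i)
    (hj : 2 ^ j ≤ lo ^ i)
    (h : 20 * hi * ((lo : ℝ) ^ 2 + lo + 1)
      < ((lo : ℝ) ^ 2 + lo + 1 - 282) * (22 * (j * 0.6931 / i)) ^ 2) :
    20 * n * ((n : ℝ) ^ 2 + n + 1) < ((n : ℝ) ^ 2 + n + 1 - 282) * (22 * Real.log n) ^ 2 := by
  have hlo : (lo : ℝ) ≤ n := by exact_mod_cast hn.1
  have hhi : (n : ℝ) ≤ hi := by exact_mod_cast hn.2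
  have hlog : j * 0.6931 / i ≤ Real.log n := by
    rw [div_le_iff₀' (by exact_mod_cast hi₀)]
    exact mul_le_mul_log (hj.trans (Nat.pow_le_pow_left hn.1 i))
  have hbound := mul_lt_sub_mul_of_le (x := (n : ℝ) ^ 2 + n + 1) (sq_nonneg _) (by norm_num)
    (by positivity) (by gcongr) h
  have hpos : 0 < (n : ℝ) ^ 2 + n + 1 - 282 :=
    pos_of_mul_pos_left (lt_of_le_of_lt (by positivity) hbound) (sq_nonneg _)
  calc _ ≤ 20 * hi * ((n : ℝ) ^ 2 + n + 1) := by gcongr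
    _ < _ := hbound
    _ ≤ _ := by gcongr

lemma second_moment_lt (hn : 31 ≤ n) (hn' : n ≤ 1096) :
    20 * n * ((n : ℝ) ^ 2 + n + 1) < ((n : ℝ) ^ 2 + n + 1 - 282) * (22 * Real.log n) ^ 2 := by
  obtain h | h | h | h : n ∈ Set.Icc 31 127 ∨ n ∈ Set.Icc 128 511 ∨ n ∈ Set.Icc 512 900
      ∨ n ∈ Set.Icc 901 1096 := by grind
  · exact second_moment_lt_of_mem_Icc (i := 1) (j := 4) h (by lia) (by lia) (by norm_num)
  · exact second_moment_lt_of_mem_Icc (i := 1) (j := 7) h (by lia) (by lia) (by norm_num)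
  · exact second_moment_lt_of_mem_Icc (i := 1) (j := 9) h (by lia) (by lia) (by norm_num)
  · exact second_moment_lt_of_mem_Icc (i := 4) (j := 39) h (by lia) (by norm_num) (by norm_num)

lemma seven_lt_log (hn : 1097 ≤ n) : 7 < Real.log n := by
  rw [Real.lt_log_iff_exp_lt (by exact_mod_cast (by lia : 0 < n))]
  calc Real.exp 7 = Real.exp 1 ^ 7 := by rw [← Real.exp_nat_mul]; norm_num
    _ < 2.7182818286 ^ 7 := by gcongr; exact Real.exp_one_lt_d9
    _ < 1097 := by norm_num
    _ ≤ n := by exact_mod_cast hn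

end Numerics

lemma exists_le_ncard_isDangerousPair [Finite P] [Finite L] (hn : ProjectivePlane.order P L = n)
    (hn₁ : 31 ≤ n) (hn₂ : n ≤ 1096) (hk : k ≤ 11) (f : {p : P // p ∉ S} → Fin k) :
    ∃ l : L, 282 ≤ {l' : L | IsDangerousPair n f l l'}.ncard := by
  have := Fintype.ofFinite P
  have := Fintype.ofFinite L
  by_contra! hfew
  have hmoment := (le_sum_typeDist_sq (D := 281) hn f fun l ↦ Nat.le_of_lt_succ (hfew l)).trans
    (sum_typeDist_sq_le hn f)
  have hs : (#{p | p ∉ S} : ℝ) ≤ (n : ℝ) ^ 2 + n + 1 := by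
    have := card_le_univ ({p | p ∉ S} : Finset P)
    rw [ProjectivePlane.card_points P L, hn] at this
    exact_mod_cast this
  have hk : (k : ℝ) ≤ 11 := by exact_mod_cast hk
  set s : ℝ := ↑(#{p | p ∉ S})
  set N : ℝ := (n : ℝ) ^ 2 + n + 1 with hN
  have hs₀ : 0 ≤ s := Nat.cast_nonneg _
  have hupper : 2 * n * (s * (k * N - s)) ≤ N * (20 * n * N) := by
    calc _ ≤ 2 * n * (s * (11 * N - s)) := by gcongr
      _ ≤ 2 * n * (10 * N ^ 2) := by
          refine mul_le_mul_of_nonneg_left ?_ (by positivity)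
          linarith [mul_nonneg (sub_nonneg.mpr hs) (by linarith : 0 ≤ 10 * N - s)]
      _ = _ := by ring
  have hlt := mul_lt_mul_of_pos_left (second_moment_lt hn₁ hn₂) (by positivity : 0 < N)
  refine absurd (hmoment.trans hupper) (not_le.mpr (hlt.trans_eq ?_))
  rw [← hN]
  push_cast
  ring

end SecondMoment

section Recolouring

open Finset Classical
open scoped Nat

variable {P L : Type*} [Membership P L] {S : Set P} {k n D r : ℕ} {f : {p : P // p ∉ S} → Fin k}

lemma lineType_eq_of_agree [Finite P] {l₁ l₂ : L} {g g' : P → Fin k}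
    (hagree : ∀ p, ¬(p ∈ l₁ ↔ p ∈ l₂) → g p = g' p) (h : lineType g l₁ = lineType g l₂) :
    lineType g' l₁ = lineType g' l₂ := by
  have := Fintype.ofFinite P
  funext i
  have hi := congrFun h i
  simp only [lineType_eq_card] at hi ⊢
  rw [← card_sdiff_eq_card_sdiff_iff] at hi ⊢
  convert hi using 2 <;> ext p <;> grind

variable [Fintype P]

/-- The points of `S` on exactly one of the two lines of `e`, if `e` is a dangerous pair, and no
points otherwise. -/
noncomputable def dangerSupport (n : ℕ) (f : {p : P // p ∉ S} → Fin k) (e : Sym2 L) : Finset P :=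
  {p | p ∈ S ∧ ∃ l₁ l₂ : L, e = s(l₁, l₂) ∧ IsDangerousPair n f l₁ l₂ ∧ p ∈ l₁ ∧ p ∉ l₂}

/-- The bad event of the local lemma: `e` is a dangerous pair, and its lines have the same type
under the colouring that is `c` on `S` and `h` off `S`. -/
def EqualTypes (n : ℕ) (f : {p : P // p ∉ S} → Fin k) (h : P → Fin k) (e : Sym2 L)
    (c : P → Fin k) : Prop :=
  ∃ l₁ l₂ : L, e = s(l₁, l₂) ∧ IsDangerousPair n f l₁ l₂ ∧
    lineType (S.piecewise c h) l₁ = lineType (S.piecewise c h) l₂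

lemma mem_dangerSupport {e : Sym2 L} {p : P} : p ∈ dangerSupport n f e ↔
    p ∈ S ∧ ∃ l₁ l₂ : L, e = s(l₁, l₂) ∧ IsDangerousPair n f l₁ l₂ ∧ p ∈ l₁ ∧ p ∉ l₂ := by
  simp [dangerSupport]

lemma IsDangerousPair.mem_dangerSupport {l₁ l₂ : L} (h : IsDangerousPair n f l₁ l₂) {p : P}
    (hp : p ∈ S) (hl : ¬(p ∈ l₁ ↔ p ∈ l₂)) : p ∈ dangerSupport n f s(l₁, l₂) := by
  rw [_root_.mem_dangerSupport]
  by_cases hp₁ : p ∈ l₁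
  · exact ⟨hp, l₁, l₂, rfl, h, hp₁, by tauto⟩
  · exact ⟨hp, l₂, l₁, Sym2.eq_swap, h.symm, by tauto, hp₁⟩

lemma EqualTypes.congr {h : P → Fin k} {e : Sym2 L} {c c' : P → Fin k}
    (hcc : ∀ p ∈ dangerSupport n f e, c p = c' p) (he : EqualTypes n f h e c) :
    EqualTypes n f h e c' := by
  obtain ⟨l₁, l₂, rfl, hd, heq⟩ := he
  refine ⟨l₁, l₂, rfl, hd, lineType_eq_of_agree (fun p hp ↦ ?_) heq⟩
  by_cases hpS : p ∈ S
  · simpa [hpS] using hcc p (hd.mem_dangerSupport hpS hp)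
  · simp [hpS]

lemma card_filter_mem_dangerSupport_le [Fintype L] {p : P}
    (hf : p ∈ S → (dangerousPairsAt L n f p).ncard ≤ D) :
    #{e : Sym2 L | p ∈ dangerSupport n f e} ≤ D := by
  by_cases hp : p ∈ S
  · refine le_trans ?_ (hf hp)
    rw [← Set.ncard_coe_finset]
    refine Set.ncard_le_ncard (fun e he ↦ ?_) (Set.toFinite _)
    obtain ⟨-, l₁, l₂, he, hd, hp₁, -⟩ := mem_dangerSupport.mp (mem_filter.mp he).2
    exact ⟨l₁, l₂, he, hd, Or.inl hp₁⟩
  · simp [mem_dangerSupport, hp]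

lemma card_recolourings_equalTypes_le {l₁ l₂ : L} {A : Finset P}
    (hA : ∀ p ∈ A, p ∈ S ∧ p ∈ l₁ ∧ p ∉ l₂) (h c : P → Fin k) :
    #{c' ∈ recolourings A c | EqualTypes n f h s(l₁, l₂) c'} ≤ (#A)! := by
  calc _ ≤ #{c' ∈ recolourings A c |
          lineType (S.piecewise c' h) l₁ = lineType (S.piecewise c' h) l₂} := by
        refine card_le_card (monotone_filter_right _ fun c' _ ↦ ?_)
        rintro ⟨l₁', l₂', he, -, heq⟩
        obtain ⟨rfl, rfl⟩ | ⟨rfl, rfl⟩ := Sym2.eq_iff.mp he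
        exacts [heq, heq.symm]
    _ ≤ #{c' ∈ recolourings A (S.piecewise c h) | lineType c' l₁ = lineType c' l₂} :=
        card_recolourings_piecewise_le (fun p hp ↦ (hA p hp).1) c h
          fun g ↦ lineType g l₁ = lineType g l₂
    _ ≤ _ := (Nat.le_mul_of_pos_right _ (balancedFactorialProd_pos k #A)).trans
        (card_recolourings_lineType_eq_mul_le (fun p hp ↦ (hA p hp).2) _)

lemma exists_recolourings_equalTypes_le (hdiff : ∀ l₁ l₂ : L, l₁ ≠ l₂ →
      r + 1 ≤ #{p | p ∈ S ∧ p ∈ l₁ ∧ p ∉ l₂})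
    (h : P → Fin k) {e : Sym2 L} {p : P} (hp : p ∈ dangerSupport n f e) :
    ∃ A ⊆ dangerSupport n f e, p ∈ A ∧ #A = r + 1 ∧
      ∀ c, #{c' ∈ recolourings A c | EqualTypes n f h e c'} ≤ (r + 1)! := by
  obtain ⟨hpS, l₁, l₂, rfl, hd, hp₁, hp₂⟩ := mem_dangerSupport.mp hp
  have hpdiff : {p} ⊆ ({p | p ∈ S ∧ p ∈ l₁ ∧ p ∉ l₂} : Finset P) := by simp [hpS, hp₁, hp₂]
  obtain ⟨A, hpA, hA, hcard⟩ := exists_subsuperset_card_eq hpdiff (by simp) (hdiff l₁ l₂ hd.1)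
  replace hA (q) (hq : q ∈ A) : q ∈ S ∧ q ∈ l₁ ∧ q ∉ l₂ := by simpa using hA hq
  refine ⟨A, fun q hq ↦ mem_dangerSupport.mpr ⟨(hA q hq).1, l₁, l₂, rfl, hd, (hA q hq).2⟩,
    singleton_subset_iff.mp hpA, hcard, fun c ↦ ?_⟩
  simpa only [hcard] using card_recolourings_equalTypes_le hA h c

lemma EntropyCond.budget_le (hk : 0 < k) (hr : 0 < r) (h : EntropyCond k D r) :
    (r * k / (r + 1) : ℝ) + D * ((r + 1)! / (r * k / (r + 1)) ^ r) ≤ k := by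
  have hcond : (D * (r + 1)! * (r + 1) ^ (r + 1) : ℝ) ≤ r ^ r * k ^ (r + 1) := by exact_mod_cast h
  have : (0 : ℝ) < k := by exact_mod_cast hk
  have : (0 : ℝ) < r := by exact_mod_cast hr
  have hweight : D * ((r + 1)! / (r * k / (r + 1) : ℝ) ^ r) ≤ k / (r + 1) := by
    rw [div_pow, mul_pow, div_div_eq_mul_div, ← mul_div_assoc,
      div_le_div_iff₀ (by positivity) (by positivity)]
    linear_combination hcond
  calc _ ≤ (r * k / (r + 1) : ℝ) + k / (r + 1) := by gcongr
    _ = k := by field_simp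

theorem exists_isLegitimate_of_entropyCond [Finite L] [ProjectivePlane P L]
    (hS : IsBalancedSet L n S) (hf : ∀ p ∈ S, (dangerousPairsAt L n f p).ncard ≤ D)
    (hk : 0 < k) (hr : 0 < r) (hcard : ∀ l : L, r + 2 ≤ #{p | p ∈ S ∧ p ∈ l})
    (hcond : EntropyCond k D r) : ∃ g : P → Fin k, IsLegitimate L g := by
  have := Fintype.ofFinite L
  have hdiff (l₁ l₂ : L) (hne : l₁ ≠ l₂) : r + 1 ≤ #{p | p ∈ S ∧ p ∈ l₁ ∧ p ∉ l₂} := by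
    have := card_le_card_diff_add_one S hne
    have := hcard l₁
    lia
  set h : P → Fin k := fun p ↦ if hp : p ∉ S then f ⟨p, hp⟩ else ⟨0, hk⟩
  set β : ℝ := r * k / (r + 1)
  have hβ₀ : 0 < β := by positivity
  obtain ⟨c, hc⟩ := exists_colouring_avoiding (U := dangerSupport (L := L) n f)
    (Bad := EqualTypes n f h) (w := fun _ ↦ (r + 1)! / β ^ r) hβ₀ (fun _ ↦ by positivity)
    (fun e c c' hcc ↦ EqualTypes.congr hcc)
    (fun e p hp ↦ by
      obtain ⟨A, hA, hpA, hAcard, hbad⟩ := exists_recolourings_equalTypes_le hdiff h hp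
      refine ⟨A, hA, hpA, fun c ↦ ?_⟩
      rw [card_erase_of_mem hpA, hAcard, Nat.add_sub_cancel, div_mul_cancel₀ _ (by positivity)]
      exact_mod_cast hbad c)
    (fun p ↦ by
      rw [sum_const, nsmul_eq_mul, Fintype.card_fin]
      refine le_trans ?_ (hcond.budget_le hk hr)
      gcongr
      exact card_filter_mem_dangerSupport_le (hf p))
    (fun e c he ↦ by
      obtain ⟨l₁, l₂, rfl, hd, -⟩ := he
      obtain ⟨p, hp⟩ := card_pos.mp ((Nat.succ_pos r).trans_le (hdiff l₁ l₂ hd.1))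
      obtain ⟨hpS, hp⟩ := (mem_filter.mp hp).2
      exact ⟨p, hd.mem_dangerSupport hpS (by tauto)⟩)
  refine ⟨S.piecewise c h, fun l₁ l₂ hne heq ↦ hc s(l₁, l₂) ⟨l₁, l₂, rfl, ⟨hne, ?_⟩, heq⟩⟩
  exact hS.typeDist_le (fun q ↦ by simp [h, q.2]) heq

end Recolouring

section Main

open Finset

variable {P L : Type*} [Membership P L] [Finite P] [Finite L] [ProjectivePlane P L] {S : Set P}
  {n k k₀ D r : ℕ} {f : {p : P // p ∉ S} → Fin k}

lemma exists_isLegitimate_of_firstMomentCond_of_le (hn : ProjectivePlane.order P L = n)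
    (h : FirstMomentCond n k₀) (hk : k₀ ≤ k) : ∃ g : P → Fin k, IsLegitimate L g := by
  obtain ⟨g, hg⟩ := exists_isLegitimate_of_firstMomentCond hn h
  exact ⟨_, hg.castLE hk⟩

lemma mul_sq_le_of_le_thirty (hn : ProjectivePlane.order P L = n) (hn₁ : n ≤ 30)
    (hS : ∀ l : L, ∃ p ∈ S, p ∈ l) (hf : ∀ p ∈ S, (dangerousPairsAt L n f p).ncard ≤ D) :
    (n + 1) * n ^ 2 ≤ D := by
  obtain ⟨-, -, -, l, -⟩ := ProjectivePlane.exists_config (P := P) (L := L)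
  obtain ⟨p, hpS, -⟩ := hS l
  have hlog := le_eleven_mul_log (hn ▸ ProjectivePlane.one_lt_order P L) hn₁
  exact (mul_sq_le_ncard_dangerousPairsAt hn p fun l₁ l₂ hne ↦
    isDangerousPair_of_le hn hS hlog hne).trans (hf p hpS)

lemma le_of_thirty_lt (hn : ProjectivePlane.order P L = n) (hn₁ : 30 < n) (hn₂ : n ≤ 1096)
    (hk : k ≤ 11) (hS : ∀ l : L, ∃ p ∈ S, p ∈ l)
    (hf : ∀ p ∈ S, (dangerousPairsAt L n f p).ncard ≤ D) : 282 ≤ D := by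
  obtain ⟨l, hl⟩ := exists_le_ncard_isDangerousPair hn hn₁ hn₂ hk f
  obtain ⟨p, hpS, hpl⟩ := hS l
  exact hl.trans ((ncard_isDangerousPair_le hpl).trans (hf p hpS))

lemma pos_of_entropyCond (hn : ProjectivePlane.order P L = n) (hS : ∀ l : L, ∃ p ∈ S, p ∈ l)
    (hf : ∀ p ∈ S, (dangerousPairsAt L n f p).ncard ≤ D) (hr : 0 < r)
    (hcond : EntropyCond k D r) : 0 < k := by
  refine Nat.pos_of_ne_zero ?_
  rintro rfl
  have hn₁ := hn ▸ ProjectivePlane.one_lt_order P L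
  obtain ⟨-, -, -, l, -⟩ := ProjectivePlane.exists_config (P := P) (L := L)
  obtain ⟨p, hpS, -⟩ := hS l
  have hdense := mul_sq_le_ncard_dangerousPairsAt (f := f) hn p fun l₁ l₂ hne ↦
    ⟨hne, by simpa using Real.log_natCast_nonneg n⟩
  have hD : 12 ≤ D := le_trans (by nlinarith) (hdense.trans (hf p hpS))
  exact absurd (hcond.eight_le hr hD) (by norm_num)

theorem exists_isLegitimate_of_order_le (hn : ProjectivePlane.order P L = n) (hn₁ : n ≤ 1096)
    (hS : IsBalancedSet L n S) (hf : ∀ p ∈ S, (dangerousPairsAt L n f p).ncard ≤ D)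
    (hr : 0 < r) (hcond : EntropyCond k D r) : ∃ g : P → Fin k, IsLegitimate L g := by
  have hn₀ : 2 ≤ n := hn ▸ ProjectivePlane.one_lt_order P L
  have hS := hS.exists_mem hn₀
  have hdense (h : n ≤ 30) : (n + 1) * n ^ 2 ≤ D := mul_sq_le_of_le_thirty hn h hS hf
  obtain h | h | h : n ≤ 3 ∨ n ∈ Set.Icc 4 6 ∨ 7 ≤ n := by grind
  · have hD : 12 ≤ D := le_trans (by nlinarith) (hdense (by lia))
    exact exists_isLegitimate_of_firstMomentCond_of_le hn (firstMomentCond_eight hn₀ h)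
      (hcond.eight_le hr hD)
  · have hD : 54 ≤ D := le_trans (by nlinarith [h.1]) (hdense (by grind))
    exact exists_isLegitimate_of_firstMomentCond_of_le hn (firstMomentCond_ten (Or.inl h))
      (hcond.ten_le hr hD)
  · refine exists_isLegitimate_of_firstMomentCond_of_le hn (firstMomentCond_twelve h) ?_
    by_contra! hk
    refine hk.not_ge (hcond.twelve_le hr ?_)
    obtain h' | h' := le_or_gt n 30
    · exact le_trans (by nlinarith) (hdense h')
    · exact le_of_thirty_lt hn h' hn₁ (by lia) hS hf

theorem exists_isLegitimate_of_lt_order (hn : ProjectivePlane.order P L = n) (hn₁ : 1096 < n)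
    (hS : IsBalancedSet L n S) (hf : ∀ p ∈ S, (dangerousPairsAt L n f p).ncard ≤ D)
    (hr : 0 < r) (hcond : EntropyCond k D r) : ∃ g : P → Fin k, IsLegitimate L g := by
  classical
  have := Fintype.ofFinite P
  have hcard (l : L) : 8 ≤ #{p | p ∈ S ∧ p ∈ l} := by
    rw [← ncard_inter_eq_card]
    exact_mod_cast (seven_lt_log hn₁).trans_le (hS l).1
  obtain hk | hk := lt_or_ge k 10
  · obtain ⟨s, hs₀, hs, hcond'⟩ := hcond.exists_le 6 (by lia) hr (by norm_num)
    have hk₀ := pos_of_entropyCond hn (hS.exists_mem (by lia)) hf hr hcond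
    exact exists_isLegitimate_of_entropyCond hS hf hk₀ hs₀
      (fun l ↦ le_trans (by lia) (hcard l)) hcond'
  · exact exists_isLegitimate_of_firstMomentCond_of_le hn
      (firstMomentCond_ten (Or.inr (by grind))) hk

end Main

theorem mainTheorem2 {P L : Type*} [Membership P L] [Finite P] [Finite L]
    [ProjectivePlane P L] (n : ℕ) (hn : ProjectivePlane.order P L = n)
    (S : Set P) (hS : IsBalancedSet L n S) (a b d : ℕ) (hd : ColorsSuffice L n S a b d) :
    ∃ f : P → Fin (max d ⌈entropyBound a b⌉₊), IsLegitimate L f := by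
  obtain ⟨f, hf⟩ := hd.mono (le_max_left d ⌈entropyBound a b⌉₊)
  obtain ⟨r, hr, hcond⟩ := exists_entropyCond (le_max_right d ⌈entropyBound a b⌉₊)
  obtain hn₁ | hn₁ := le_or_gt n 1096
  · exact exists_isLegitimate_of_order_le hn hn₁ hS hf hr hcond
  · exact exists_isLegitimate_of_lt_order hn hn₁ hS hf hr hcond
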